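/- Let $k$ be a field of characteristic zero and let $F=k(x)$ be the rational function field over $k$ with derivation $\partial=\frac{d}{dx}$. Let $R/F$ be a Picard–Vessiot ring; that is, $R$ is a (commutative) differential ring extension of $F$ such that, for some $n\ge 0$ and some matrix $A\in F^{n\times n}$: there is a matrix $Y\in \mathrm{GL}_n(R)$ with $\partial(Y)=A\cdot Y$ and $R=F[Y,\det(Y)^{-1}]$ (i.e. $R$ is generated as an $F$-algebra by the entries of $Y$ and by $\det(Y)^{-1}$); $R$ is a simple differential ring (it is nonzero and its only ideals stable under $\partial$ are $0$ and $R$); and the constants of $R$ are exactly the constants of $F$. Then there exist an element $\alpha\in k$ and a finite field extension $k'/k$ such that $R$ embeds into $k'((x-\alpha))$ as a differential $k(x)$-algebra. Here $k'((x-\alpha))$ is the field of formal Laurent series over $k'$ in the variable $w=x-\alpha$, with derivation $\frac{d}{dw}\colon\sum_i a_iw^i\mapsto\sum_i i\,a_iw^{i-1}$, and it is a $k(x)$-algebra through the inclusion that is $k\subseteq k'$ on constants and sends $x$ to $\alpha+w$; thus the claim is that there is an injective homomorphism of $k(x)$-algebras $R\to k'((x-\alpha))$ that commutes with the derivations. 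-/

import Mathlib

open scoped Differential

universe u v

noncomputable section

namespace PicardVessiot

/-- A differential ring structure from an additive map that satisfies the product rule. -/
abbrev mkDifferential {R : Type*} [CommRing R] (D : R →+ R)
    (hD : ∀ a b, D (a * b) = a * D b + b * D a) : Differential R where
  deriv := Derivation.mk' D.toIntLinearMap hD

/-! ### The differential field `k(x)` with `d/dx` -/

/-- The quotient rule `(p / q)' = (p' q - p q') / q ^ 2`, applied to the reduced fraction of `f`. -/
def ratDeriv {k : Type*} [Field k] (f : RatFunc k) : RatFunc k :=
  algebraMap (Polynomial k) (RatFunc k)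
      (Polynomial.derivative f.num * f.denom - f.num * Polynomial.derivative f.denom) /
    algebraMap (Polynomial k) (RatFunc k) f.denom ^ 2

/-- The quotient rule holds for every fraction representing a rational function. -/
lemma ratDeriv_div {k : Type*} [Field k] (p q : Polynomial k) (hq : q ≠ 0) :
    ratDeriv (algebraMap (Polynomial k) (RatFunc k) p / algebraMap (Polynomial k) (RatFunc k) q) =
      algebraMap (Polynomial k) (RatFunc k)
          (Polynomial.derivative p * q - p * Polynomial.derivative q) /
        algebraMap (Polynomial k) (RatFunc k) q ^ 2 := by
  set f : RatFunc k :=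
    algebraMap (Polynomial k) (RatFunc k) p / algebraMap (Polynomial k) (RatFunc k) q with hf
  have hd : f.denom ≠ 0 := f.denom_ne_zero
  have hq' : algebraMap (Polynomial k) (RatFunc k) q ≠ 0 := RatFunc.algebraMap_ne_zero hq
  have hd' : algebraMap (Polynomial k) (RatFunc k) f.denom ≠ 0 := RatFunc.algebraMap_ne_zero hd
  have key : f.num * q = p * f.denom := by
    apply RatFunc.algebraMap_injective k
    have h := RatFunc.num_div_denom f
    rw [hf, div_eq_div_iff (hf ▸ hd') hq'] at h
    simpa only [map_mul] using h
  have dkey := congrArg Polynomial.derivative key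
  rw [Polynomial.derivative_mul, Polynomial.derivative_mul] at dkey
  rw [ratDeriv, div_eq_div_iff (pow_ne_zero 2 hd') (pow_ne_zero 2 hq'), ← map_pow, ← map_pow,
    ← map_mul, ← map_mul]
  congr 1
  linear_combination (q * f.denom) * dkey -
    (q * Polynomial.derivative f.denom + f.denom * Polynomial.derivative q) * key

/-- The rational function field `k(x)` as a differential field, with derivation `d/dx`. -/
instance instDifferentialRatFunc {k : Type*} [Field k] : Differential (RatFunc k) :=
  mkDifferential
    (AddMonoidHom.mk' ratDeriv <| by
      intro f g
      induction f using RatFunc.induction_on with | _ p q hq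
      induction g using RatFunc.induction_on with | _ r s hs
      have hq' := RatFunc.algebraMap_ne_zero hq
      have hs' := RatFunc.algebraMap_ne_zero hs
      rw [div_add_div _ _ hq' hs', ← map_mul, ← map_mul, ← map_mul, ← map_add,
        ratDeriv_div _ _ (mul_ne_zero hq hs), ratDeriv_div _ _ hq, ratDeriv_div _ _ hs]
      simp only [Polynomial.derivative_mul, map_mul, map_add, map_sub]
      field_simp
      ring)
    (by
      intro f g
      change ratDeriv (f * g) = f * ratDeriv g + g * ratDeriv f
      induction f using RatFunc.induction_on with | _ p q hq
      induction g using RatFunc.induction_on with | _ r s hs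
      have hq' := RatFunc.algebraMap_ne_zero hq
      have hs' := RatFunc.algebraMap_ne_zero hs
      rw [div_mul_div_comm, ← map_mul, ← map_mul,
        ratDeriv_div _ _ (mul_ne_zero hq hs), ratDeriv_div _ _ hq, ratDeriv_div _ _ hs]
      simp only [Polynomial.derivative_mul, map_mul, map_add, map_sub]
      field_simp
      ring)

/-! ### The differential field `K((w))` with `d/dw` -/

/-- The product rule for the formal derivative of Laurent series. -/
lemma laurent_leibniz {K : Type*} [Field K] (f g : LaurentSeries K) :
    LaurentSeries.derivative K (f * g) =
      f * LaurentSeries.derivative K g + g * LaurentSeries.derivative K f := by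
  -- It suffices to treat the Euler operator `w d/dw`, which does not shift exponents.
  have hE : ∀ h : LaurentSeries K, ∀ m : ℤ,
      (HahnSeries.single (1 : ℤ) (1 : K) * LaurentSeries.derivative K h).coeff m
        = m * h.coeff m := by
    intro h m
    have := HahnSeries.coeff_single_mul_add (r := (1 : K)) (x := LaurentSeries.derivative K h)
      (a := m - 1) (b := 1)
    rw [sub_add_cancel] at this
    rw [this, LaurentSeries.derivative_apply, LaurentSeries.hasseDeriv_coeff]
    simp
  have hw : (HahnSeries.single (1 : ℤ) (1 : K)) ≠ 0 := by simp
  apply mul_left_cancel₀ hw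
  rw [mul_add, mul_left_comm, mul_left_comm _ g]
  have hS : ∀ h : LaurentSeries K,
      (HahnSeries.single (1 : ℤ) (1 : K) * LaurentSeries.derivative K h).support ⊆ h.support := by
    intro h m hm
    rw [HahnSeries.mem_support, hE] at hm
    exact right_ne_zero_of_mul hm
  ext m
  rw [hE, HahnSeries.coeff_add, mul_comm g,
    HahnSeries.coeff_mul_right' g.isPWO_support (hS g),
    HahnSeries.coeff_mul_left' f.isPWO_support (hS f), HahnSeries.coeff_mul, Finset.mul_sum,
    ← Finset.sum_add_distrib]
  refine Finset.sum_congr rfl fun ij hij ↦ ?_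
  obtain ⟨-, -, hm⟩ := Finset.mem_antidiagonal.mp hij
  rw [hE, hE, ← hm]
  push_cast
  ring

/-- The field of formal Laurent series `K((w))` as a differential field, with derivation
`∑ aᵢ wⁱ ↦ ∑ i aᵢ wⁱ⁻¹`. -/
instance instDifferentialLaurentSeries {K : Type*} [Field K] : Differential (LaurentSeries K) :=
  mkDifferential (LaurentSeries.derivative K).toAddMonoidHom laurent_leibniz

/-! ### Expansion of rational functions at a point -/

/-- `p ↦ p(α + w)` as a map `k[x] → k'((w))`. -/
def polyExpansion {k : Type*} (k' : Type*) [Field k] [Field k'] [Algebra k k'] (α : k) :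
    Polynomial k →+* LaurentSeries k' :=
  Polynomial.eval₂RingHom (HahnSeries.C.comp (algebraMap k k'))
    (HahnSeries.C (algebraMap k k' α) + HahnSeries.single 1 1)

lemma polyExpansion_injective {k : Type*} (k' : Type*) [Field k] [Field k'] [Algebra k k']
    (α : k) : Function.Injective (polyExpansion k' α) := by
  have h : polyExpansion k' α = (HahnSeries.ofPowerSeries ℤ k').comp
      ((Polynomial.coeToPowerSeries.ringHom (R := k')).comp
        ((Polynomial.mapRingHom (algebraMap k k')).comp
          (Polynomial.taylorAlgHom α : Polynomial k →+* Polynomial k))) := by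
    apply Polynomial.ringHom_ext
    · intro a
      simp [polyExpansion]
    · simp [polyExpansion, add_comm]
  rw [h]
  exact HahnSeries.ofPowerSeries_injective.comp ((Polynomial.coe_injective k').comp
    ((Polynomial.map_injective _ (algebraMap k k').injective).comp
      (Polynomial.taylor_injective α)))

/-- The inclusion `k(x) → k'((x - α))`: the field `k'((x - α))` is the field of Laurent series over
`k'` in the variable `w = x - α`, and the inclusion is the one that sends `x` to `α + w` and
restricts to `k → k'` on constants. -/
def ratExpansion {k : Type*} (k' : Type*) [Field k] [Field k'] [Algebra k k'] (α : k) :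
    RatFunc k →+* LaurentSeries k' :=
  RatFunc.liftRingHom (polyExpansion k' α)
    (nonZeroDivisors_le_comap_nonZeroDivisors_of_injective _ (polyExpansion_injective k' α))

/-! ### Picard-Vessiot rings -/

/-- A differential ring `R` is simple if it is nonzero and its only ideals that are stable under
the derivation are `0` and `R`. -/
def IsSimpleDifferentialRing (R : Type*) [CommRing R] [Differential R] : Prop :=
  Nontrivial R ∧ ∀ I : Ideal R, (∀ a ∈ I, a′ ∈ I) → I = ⊥ ∨ I = ⊤

/-- `R` is a Picard-Vessiot ring over the differential field `F` for the equation `∂(y) = A y`. -/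
structure IsPicardVessiotRingFor {F : Type*} [Field F] [Differential F] {n : ℕ}
    (A : Matrix (Fin n) (Fin n) F) (R : Type*) [CommRing R] [Differential R] [Algebra F R]
    [DifferentialAlgebra F R] : Prop where
  /-- There is a fundamental solution matrix `Y`, and `R = F[Y, det(Y)⁻¹]`. -/
  exists_fundamental : ∃ Y : GL (Fin n) R,
    Y.val.map (fun r ↦ r′) = A.map (algebraMap F R) * Y.val ∧
    Algebra.adjoin F
      (Set.range (fun ij : Fin n × Fin n ↦ Y.val ij.1 ij.2) ∪
        {((Matrix.GeneralLinearGroup.det Y)⁻¹ : Rˣ).val}) = ⊤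
  /-- `R` is a simple differential ring. -/
  simple : IsSimpleDifferentialRing R
  /-- The constants of `R` are the constants of `F`. -/
  constants : ∀ r : R, r′ = 0 ↔ ∃ c : F, c′ = 0 ∧ algebraMap F R c = r

/-- `R` is a Picard-Vessiot ring over `F`, for some linear differential equation over `F`. -/
def IsPicardVessiotRing (F : Type*) [Field F] [Differential F] (R : Type*) [CommRing R]
    [Differential R] [Algebra F R] [DifferentialAlgebra F R] : Prop :=
  ∃ (n : ℕ) (A : Matrix (Fin n) (Fin n) F), IsPicardVessiotRingFor A R

end PicardVessiot

end

noncomputable section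

namespace PicardVessiot

/-! ### Taylor expansion along a point of a differential ring -/

section Taylor

variable {S K : Type*} [CommRing S] [Field K] (D : Derivation ℤ S S) (ψ : S →+* K)

/-! In a simple differential ring every differential homomorphism to a nonzero ring is injective
(`injective_of_isSimple`), so any differential `k(x)`-homomorphism to Laurent series suffices. Such
a map comes from Taylor expansion at a point: a ring homomorphism `ψ : S → K`, with no compatibility
with `D`, yields the differential homomorphism `taylorHom`. Here `S` is generated by the entries of
`Y` and `det(Y)⁻¹` over the functions regular at `α`; it is stable under the derivation once `A` has
no pole at `α`. The point `ψ` comes from `exists_point`: a residue field of `R` is finite over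
`k(x)`, its generators are integral over the local ring at almost every `α`, and lying-over yields a
finite extension of `k`. Finally `R` is a localization of `S` (`isLocalization_adjoin_regularAt`),
so the expansion extends to `R`. -/

/-- The formal Taylor series `∑ ψ(Dⁿ s) / n! · Xⁿ`. -/
def taylorFun (s : S) : PowerSeries K :=
  PowerSeries.mk fun n ↦ ψ (D^[n] s) / (n.factorial : K)

lemma constantCoeff_taylorFun (s : S) :
    PowerSeries.constantCoeff (taylorFun D ψ s) = ψ s := by
  rw [← PowerSeries.coeff_zero_eq_constantCoeff_apply]
  simp [taylorFun]

lemma taylorFun_add (s t : S) : taylorFun D ψ (s + t) = taylorFun D ψ s + taylorFun D ψ t := by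
  ext n
  simp [taylorFun, iterate_map_add, add_div]

variable [CharZero K]

lemma derivative_taylorFun (s : S) :
    PowerSeries.derivative K (taylorFun D ψ s) = taylorFun D ψ (D s) := by
  ext n
  have h : (n.factorial : K) ≠ 0 := by exact_mod_cast n.factorial_ne_zero
  have h' : (n : K) + 1 ≠ 0 := by exact_mod_cast n.succ_ne_zero
  rw [PowerSeries.coeff_derivative]
  simp only [taylorFun, PowerSeries.coeff_mk, Function.iterate_succ_apply, Nat.factorial_succ]
  push_cast
  field_simp

/-- Coefficient `n + 1` is read off from coefficient `n` of the derivative, where the Leibniz rule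
leaves the pairs `(s, D t)` and `(D s, t)`; hence the induction over all `s`, `t`. -/
lemma taylorFun_mul (s t : S) : taylorFun D ψ (s * t) = taylorFun D ψ s * taylorFun D ψ t := by
  ext n
  induction n generalizing s t with
  | zero =>
    simp only [PowerSeries.coeff_zero_eq_constantCoeff_apply, map_mul, constantCoeff_taylorFun]
  | succ n ih =>
    have h' : (n : K) + 1 ≠ 0 := by exact_mod_cast n.succ_ne_zero
    apply mul_right_cancel₀ h'
    rw [← PowerSeries.coeff_derivative, ← PowerSeries.coeff_derivative, derivative_taylorFun,
      Derivation.leibniz, Derivation.leibniz, derivative_taylorFun, derivative_taylorFun,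
      taylorFun_add]
    simp only [smul_eq_mul, map_add, ih]

lemma taylorFun_of_deriv_eq_zero {s : S} (hs : D s = 0) :
    taylorFun D ψ s = PowerSeries.C (ψ s) := by
  apply PowerSeries.derivative.ext
  · rw [derivative_taylorFun, hs, PowerSeries.derivative_C]
    ext n
    simp [taylorFun, iterate_map_zero]
  · rw [constantCoeff_taylorFun, PowerSeries.constantCoeff_C]

lemma taylorFun_of_deriv_eq_one {s : S} (hs : D s = 1) :
    taylorFun D ψ s = PowerSeries.C (ψ s) + PowerSeries.X := by
  apply PowerSeries.derivative.ext
  · rw [derivative_taylorFun, hs, map_add, PowerSeries.derivative_C, PowerSeries.derivative_X,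
      taylorFun_of_deriv_eq_zero D ψ D.map_one_eq_zero, map_one, map_one, zero_add]
  · simp [constantCoeff_taylorFun]

/-- The Taylor series as a ring homomorphism. -/
def taylorHom : S →+* PowerSeries K where
  toFun := taylorFun D ψ
  map_one' := by
    rw [taylorFun_of_deriv_eq_zero D ψ D.map_one_eq_zero, map_one, map_one]
  map_mul' := taylorFun_mul D ψ
  map_zero' := by
    rw [taylorFun_of_deriv_eq_zero D ψ (map_zero D), map_zero, map_zero]
  map_add' := taylorFun_add D ψ

end Taylor

lemma deriv_ofPowerSeries {K : Type*} [Field K] (f : PowerSeries K) :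
    (HahnSeries.ofPowerSeries ℤ K f)′ =
      HahnSeries.ofPowerSeries ℤ K (PowerSeries.derivative K f) := by
  change LaurentSeries.derivative K _ = _
  ext n
  rw [LaurentSeries.derivative_apply, LaurentSeries.hasseDeriv_coeff]
  obtain ⟨m, rfl⟩ | hn : (∃ m : ℕ, n = m) ∨ n < 0 := by
    rcases le_or_gt 0 n with h | h
    · exact Or.inl ⟨n.toNat, by simp [h]⟩
    · exact Or.inr h
  · rw [LaurentSeries.coeff_coe_powerSeries, PowerSeries.coeff_derivative]
    have : ((m : ℤ) + (1 : ℕ)) = ((m + 1 : ℕ) : ℤ) := by push_cast; rfl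
    rw [this, LaurentSeries.coeff_coe_powerSeries]
    simp [mul_comm]
  · rw [PowerSeries.coeff_coe, PowerSeries.coeff_coe, if_pos hn]
    split_ifs with h
    · simp
    -- At exponent `-1` the constant term is hit, but with factor `n + 1 = 0`.
    · obtain rfl : n = -1 := by push_cast at h; omega
      simp

/-! ### Rational functions regular at a point -/

section Regular

variable {k : Type*} [Field k]

/-- The rational functions without pole at `α`. -/
def regularAt (α : k) : Subalgebra k (RatFunc k) where
  carrier := {f | f.denom.eval α ≠ 0}
  mul_mem' {f g} hf hg h := by
    have := Polynomial.eval_dvd (RatFunc.denom_mul_dvd f g) (x := α)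
    rw [h, zero_dvd_iff, Polynomial.eval_mul] at this
    exact mul_ne_zero hf hg this
  add_mem' {f g} hf hg h := by
    have := Polynomial.eval_dvd (RatFunc.denom_add_dvd f g) (x := α)
    rw [h, zero_dvd_iff, Polynomial.eval_mul] at this
    exact mul_ne_zero hf hg this
  algebraMap_mem' c := by
    change (algebraMap k (RatFunc k) c).denom.eval α ≠ 0
    rw [RatFunc.algebraMap_eq_C, RatFunc.denom_C, Polynomial.eval_one]
    exact one_ne_zero

lemma mem_regularAt {α : k} {f : RatFunc k} : f ∈ regularAt α ↔ f.denom.eval α ≠ 0 := Iff.rfl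

lemma algebraMap_mem_regularAt (α : k) (p : Polynomial k) :
    algebraMap (Polynomial k) (RatFunc k) p ∈ regularAt α := by
  rw [mem_regularAt, RatFunc.denom_algebraMap, Polynomial.eval_one]
  exact one_ne_zero

lemma deriv_mem_regularAt {α : k} {f : RatFunc k} (hf : f ∈ regularAt α) :
    f′ ∈ regularAt α := by
  intro h
  have h1 : (ratDeriv f).denom ∣ f.denom ^ 2 := by
    rw [ratDeriv, ← map_pow]
    exact RatFunc.denom_div_dvd _ _
  have := Polynomial.eval_dvd h1 (x := α)
  rw [Polynomial.eval_pow] at this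
  change Polynomial.eval α (ratDeriv f).denom = 0 at h
  rw [h, zero_dvd_iff] at this
  exact hf (pow_eq_zero_iff two_ne_zero |>.mp this)

/-- Evaluation at `α` of the rational functions that are regular there. -/
def evalAt (α : k) : regularAt α →+* k where
  toFun f := RatFunc.eval (RingHom.id k) α f
  map_one' := by simp
  map_zero' := by simp
  map_mul' f g := RatFunc.eval_mul _ _ f.2 g.2
  map_add' f g := RatFunc.eval_add _ _ f.2 g.2

lemma evalAt_algebraMap (α c : k) : evalAt α (algebraMap k (regularAt α) c) = c := by
  change RatFunc.eval (RingHom.id k) α (algebraMap k (RatFunc k) c) = c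
  rw [RatFunc.algebraMap_eq_C, RatFunc.eval_C, RingHom.id_apply]

/-- The product of the denominators is a nonzero polynomial, so it cannot vanish on all of an
infinite field. -/
lemma exists_forall_mem_regularAt [Infinite k] (s : Finset (RatFunc k)) :
    ∃ α : k, ∀ f ∈ s, f ∈ regularAt α := by
  have h : ∏ f ∈ s, f.denom ≠ 0 := Finset.prod_ne_zero_iff.mpr fun f _ ↦ f.denom_ne_zero
  by_contra! hc
  refine h (Polynomial.eq_zero_of_infinite_isRoot _ (Set.infinite_univ.mono fun α _ ↦ ?_))
  obtain ⟨f, hf, hα⟩ := hc α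
  rw [mem_regularAt, not_not] at hα
  rw [Set.mem_ofPred_eq, Polynomial.IsRoot, Polynomial.eval_prod]
  exact Finset.prod_eq_zero hf hα

lemma exists_mul_mem_regularAt (α : k) (f : RatFunc k) :
    ∃ a ∈ regularAt α, a ≠ 0 ∧ a * f ∈ regularAt α := by
  refine ⟨algebraMap _ _ f.denom, algebraMap_mem_regularAt α _,
    RatFunc.algebraMap_ne_zero f.denom_ne_zero, ?_⟩
  nth_rewrite 2 [← RatFunc.num_div_denom f]
  rw [mul_div_cancel₀ _ (RatFunc.algebraMap_ne_zero f.denom_ne_zero)]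
  exact algebraMap_mem_regularAt α _

lemma deriv_ratFunc_C (c : k) : (RatFunc.C c : RatFunc k)′ = 0 := by
  change ratDeriv (RatFunc.C c) = 0
  simp [ratDeriv]

lemma deriv_ratFunc_X : (RatFunc.X : RatFunc k)′ = 1 := by
  change ratDeriv RatFunc.X = 1
  simp [ratDeriv]

end Regular

/-! ### Points of finite algebras -/

/-- Lying-over: the maximal ideal `ker ev` is the contraction of a maximal ideal `Q` of `B`, and `B
⧸ Q` is finite over `A / ker ev = k`. -/
lemma exists_finite_point {k : Type u} [Field k] {A B : Type*} [CommRing A] [CommRing B]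
    [Algebra A B] [Module.Finite A B] (ev : A →+* k) (hev : Function.Surjective ev)
    (hker : RingHom.ker (algebraMap A B) ≤ RingHom.ker ev) :
    ∃ (L : Type u) (_ : Field L) (_ : Algebra k L) (ψ : B →+* L), FiniteDimensional k L ∧
      ∀ a, ψ (algebraMap A B a) = algebraMap k L (ev a) := by
  have := RingHom.ker_isMaximal_of_surjective ev hev
  obtain ⟨Q, hQ, hQA⟩ :=
    Ideal.exists_ideal_over_maximal_of_isIntegral (S := B) (RingHom.ker ev) hker
  let := Ideal.Quotient.field Q
  let g : k →+* B ⧸ Q := (RingHom.liftOfSurjective ev hev)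
    ⟨(algebraMap A (B ⧸ Q)), fun a ha ↦ by
      rw [RingHom.mem_ker, IsScalarTower.algebraMap_apply A B, Ideal.Quotient.algebraMap_eq,
        Ideal.Quotient.eq_zero_iff_mem]
      exact hQA.ge ha⟩
  have hg (a : A) : g (ev a) = algebraMap A (B ⧸ Q) a :=
    RingHom.liftOfRightInverse_comp_apply _ _ _ _ _
  let := g.toAlgebra
  let := ev.toAlgebra
  have : IsScalarTower A k (B ⧸ Q) := IsScalarTower.of_algebraMap_eq fun a ↦ (hg a).symm
  have : Module.Finite A (B ⧸ Q) := Module.Finite.trans B _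
  have : Module.Finite k (B ⧸ Q) := Module.Finite.of_restrictScalars_finite A k _
  -- The image in `AlgebraicClosure k` replaces `B ⧸ Q` by a copy in the universe of `k`.
  let j : B ⧸ Q →ₐ[k] AlgebraicClosure k := IsAlgClosed.lift
  let e : (B ⧸ Q) ≃ₐ[k] j.fieldRange := AlgEquiv.ofInjectiveField j
  refine ⟨j.fieldRange, inferInstance, inferInstance,
    e.toAlgHom.toRingHom.comp (Ideal.Quotient.mk Q), ?_, fun a ↦ ?_⟩
  · exact Module.Finite.equiv e.toLinearEquiv
  · have : Ideal.Quotient.mk Q (algebraMap A B a) = algebraMap k (B ⧸ Q) (ev a) := (hg a).symm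
    rw [RingHom.comp_apply, this]
    exact e.commutes _

lemma isIntegral_of_minpoly_coeff_mem {k F E : Type*} [Field k] [Field F] [Field E] [Algebra k F]
    [Algebra F E] (A : Subalgebra k F) {x : E} (hx : IsIntegral F x)
    (h : ∀ n, (minpoly F x).coeff n ∈ A) : IsIntegral A x := by
  have hl : minpoly F x ∈ Polynomial.lifts (algebraMap A F) :=
    (Polynomial.lifts_iff_coeff_lifts _).mpr fun n ↦ ⟨⟨_, h n⟩, rfl⟩
  obtain ⟨p, hp, -, hm⟩ := Polynomial.lifts_and_degree_eq_and_monic hl (minpoly.monic hx)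
  refine ⟨p, hm, ?_⟩
  have := minpoly.aeval F x
  rwa [← hp, Polynomial.aeval_def, Polynomial.eval₂_map] at this

/-- A finitely generated algebra over `k(x)` has, for suitable `α ∈ k`, a model over the local ring
at `α` with a point above `α` that is rational over a finite extension of `k`. -/
lemma exists_point {k : Type u} [Field k] [Infinite k] {R : Type v} [CommRing R] [Nontrivial R]
    [Algebra (RatFunc k) R] {G : Set R} (hGfin : G.Finite)
    (hG : Algebra.adjoin (RatFunc k) G = ⊤) (s : Finset (RatFunc k)) :
    ∃ α : k, (∀ f ∈ s, f ∈ regularAt α) ∧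
      ∃ (L : Type u) (_ : Field L) (_ : Algebra k L)
        (ψ : Algebra.adjoin (regularAt α) G →+* L), FiniteDimensional k L ∧
        ∀ a, ψ (algebraMap (regularAt α) _ a) = algebraMap k L (evalAt α a) := by
  classical
  -- The ideal `m` need not be differential. By Zariski's lemma `R ⧸ m` is finite over `k(x)`.
  obtain ⟨m, hm⟩ := Ideal.exists_maximal R
  let := Ideal.Quotient.field m
  have : Algebra.FiniteType (RatFunc k) R := ⟨⟨hGfin.toFinset, by simpa using hG⟩⟩
  have : Module.Finite (RatFunc k) (R ⧸ m) := finite_of_finite_type_of_isJacobsonRing _ _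
  let q : R →ₐ[RatFunc k] R ⧸ m := Ideal.Quotient.mkₐ _ m
  -- Besides the poles of `s`, `α` avoids those of the minimal polynomials of the generators modulo
  -- `m`, which makes their images integral over `regularAt α`.
  obtain ⟨α, hα⟩ := exists_forall_mem_regularAt
    (s ∪ hGfin.toFinset.biUnion fun y ↦ (minpoly (RatFunc k) (q y)).coeffs)
  refine ⟨α, fun f hf ↦ hα f (Finset.mem_union_left _ hf), ?_⟩
  have hint : ∀ y ∈ q '' G, IsIntegral (regularAt α) y := by
    rintro _ ⟨y, hy, rfl⟩
    refine isIntegral_of_minpoly_coeff_mem _ (IsIntegral.of_finite _ _) fun n ↦ ?_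
    by_cases h : (minpoly (RatFunc k) (q y)).coeff n = 0
    · rw [h]
      exact zero_mem _
    · exact hα _ (Finset.mem_union_right _ (Finset.mem_biUnion.mpr
        ⟨y, hGfin.mem_toFinset.mpr hy, Polynomial.coeff_mem_coeffs h⟩))
  have := Algebra.finite_adjoin_of_finite_of_isIntegral (hGfin.image q) hint
  obtain ⟨L, _, _, ψ, hL, hψ⟩ := exists_finite_point
    (B := Algebra.adjoin (regularAt α) (q '' G)) (evalAt α)
    (fun c ↦ ⟨_, evalAt_algebraMap α c⟩) (by
      intro a ha
      have h : algebraMap (RatFunc k) (R ⧸ m) a = 0 := congrArg Subtype.val ha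
      rw [map_eq_zero, ZeroMemClass.coe_eq_zero] at h
      rw [h]
      exact zero_mem _)
  let q' : R →ₐ[regularAt α] R ⧸ m := q.restrictScalars _
  let r : Algebra.adjoin (regularAt α) G →ₐ[regularAt α] Algebra.adjoin (regularAt α) (q '' G) :=
    (q'.comp (Subalgebra.val _)).codRestrict _ fun x ↦ by
      have h : q' x ∈ (Algebra.adjoin (regularAt α) G).map q' := ⟨x, x.2, rfl⟩
      rwa [AlgHom.map_adjoin] at h
  exact ⟨L, _, _, ψ.comp (r : _ →+* _), hL, fun a ↦ by
    rw [RingHom.comp_apply, RingHom.coe_coe, AlgHom.commutes, hψ]⟩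

/-! ### Recovering `R` from its model over the local ring at `α` -/

section Model

variable {k : Type*} [Field k] {R : Type*} [CommRing R] [Algebra (RatFunc k) R] {G : Set R}

lemma exists_smul_mem_adjoin_regularAt (α : k) (hG : Algebra.adjoin (RatFunc k) G = ⊤) (r : R) :
    ∃ a : regularAt α, a ≠ 0 ∧ a • r ∈ Algebra.adjoin (regularAt α) G := by
  have hr : r ∈ Algebra.adjoin (RatFunc k) G := hG ▸ Algebra.mem_top
  induction hr using Algebra.adjoin_induction with
  | mem x hx => exact ⟨1, one_ne_zero, by simpa using Algebra.subset_adjoin hx⟩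
  | algebraMap f =>
    obtain ⟨a, ha, ha0, haf⟩ := exists_mul_mem_regularAt α f
    refine ⟨⟨a, ha⟩, fun h ↦ ha0 (congrArg Subtype.val h), ?_⟩
    convert (Algebra.adjoin (regularAt α) G).algebraMap_mem ⟨_, haf⟩ using 1
    change a • algebraMap (RatFunc k) R f = algebraMap (RatFunc k) R (a * f)
    rw [map_mul, Algebra.smul_def]
  | add x y _ _ hx hy =>
    obtain ⟨a, ha, hx⟩ := hx
    obtain ⟨b, hb, hy⟩ := hy
    refine ⟨a * b, mul_ne_zero ha hb, ?_⟩
    rw [smul_add, mul_smul, mul_smul, smul_comm a b x]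
    exact add_mem (Subalgebra.smul_mem _ hx b) (Subalgebra.smul_mem _ hy a)
  | mul x y _ _ hx hy =>
    obtain ⟨a, ha, hx⟩ := hx
    obtain ⟨b, hb, hy⟩ := hy
    refine ⟨a * b, mul_ne_zero ha hb, ?_⟩
    rw [← smul_mul_smul_comm]
    exact mul_mem hx hy

lemma isLocalization_adjoin_regularAt (α : k) (hG : Algebra.adjoin (RatFunc k) G = ⊤) :
    IsLocalization (Algebra.algebraMapSubmonoid (Algebra.adjoin (regularAt α) G)
      (nonZeroDivisors (regularAt α))) R where
  map_units := by
    rintro ⟨_, a, ha, rfl⟩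
    have h : (a : RatFunc k) ≠ 0 := fun h ↦ nonZeroDivisors.ne_zero ha (Subtype.ext h)
    exact (IsUnit.mk0 _ h).map (algebraMap (RatFunc k) R)
  surj r := by
    obtain ⟨a, ha, har⟩ := exists_smul_mem_adjoin_regularAt α hG r
    refine ⟨(⟨_, har⟩, ⟨algebraMap _ _ a, a, mem_nonZeroDivisors_of_ne_zero ha, rfl⟩), ?_⟩
    change r * algebraMap (regularAt α) R a = a • r
    rw [Algebra.smul_def, mul_comm]
  exists_of_eq {x y} h := ⟨1, by rw [Subtype.ext h]⟩

end Model

/-! ### Differential homomorphisms and the embedding -/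

lemma deriv_mem_adjoin {A R : Type*} [CommRing A] [CommRing R] [Algebra A R]
    (D : Derivation ℤ R R) {G : Set R}
    (hA : ∀ a : A, D (algebraMap A R a) ∈ Algebra.adjoin A G)
    (hG : ∀ g ∈ G, D g ∈ Algebra.adjoin A G) {r : R} (hr : r ∈ Algebra.adjoin A G) :
    D r ∈ Algebra.adjoin A G := by
  induction hr using Algebra.adjoin_induction with
  | mem x hx => exact hG x hx
  | algebraMap a => exact hA a
  | add x y _ _ hx hy => rw [map_add]; exact add_mem hx hy
  | mul x y hx' hy' hx hy =>
    rw [Derivation.leibniz]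
    exact add_mem (mul_mem hx' hy) (mul_mem hy' hx)

/-- A differential homomorphism into a differential field extends to localizations. -/
lemma lift_deriv {S R K : Type*} [CommRing S] [CommRing R] [Field K] [Differential R]
    [Differential K] [Algebra S R] (M : Submonoid S) [IsLocalization M R]
    (D : S → S) (hD : ∀ s, algebraMap S R (D s) = (algebraMap S R s)′)
    (φ : R →+* K)
    (hφ : ∀ s, φ (algebraMap S R (D s)) = (φ (algebraMap S R s))′) (r : R) :
    φ r′ = (φ r)′ := by
  obtain ⟨⟨s, m⟩, h⟩ := IsLocalization.surj M r
  have hm : φ (algebraMap S R m) ≠ 0 := ((IsLocalization.map_units R m).map φ).ne_zero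
  apply mul_right_cancel₀ hm
  -- The relation `r * m = s` is differentiated once in `R` and once in `K`; the terms in `s` and
  -- `m` match by `hφ`.
  have h1 := congrArg (fun z ↦ φ z′) h
  have h2 := congrArg (fun z ↦ (φ z)′) h
  simp only [Derivation.leibniz, smul_eq_mul, map_add, map_mul, ← hD, hφ] at h1 h2
  linear_combination h1 - h2

/-- The kernel is a differential ideal, and proper because the target is nonzero. -/
lemma injective_of_isSimple {R K : Type*} [CommRing R] [Differential R]
    [CommRing K] [Nontrivial K] [Differential K] (hR : IsSimpleDifferentialRing R) (φ : R →+* K)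
    (hφ : ∀ r, φ r′ = (φ r)′) : Function.Injective φ := by
  rw [RingHom.injective_iff_ker_eq_bot]
  refine (hR.2 (RingHom.ker φ) fun a ha ↦ ?_).resolve_right (RingHom.ker_ne_top φ)
  rw [RingHom.mem_ker] at ha ⊢
  rw [hφ, ha, map_zero]

/-- The restriction of a derivation to a stable subalgebra. -/
def restrictDerivation {A R : Type*} [CommRing A] [CommRing R] [Algebra A R]
    (D : Derivation ℤ R R) (S : Subalgebra A R) (h : ∀ r ∈ S, D r ∈ S) : Derivation ℤ S S :=
  Derivation.mk' (AddMonoidHom.toIntLinearMap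
    { toFun := fun s ↦ ⟨D s, h s s.2⟩
      map_zero' := Subtype.ext (map_zero D)
      map_add' := fun a b ↦ Subtype.ext (map_add D (a : R) b) })
    fun a b ↦ Subtype.ext (D.leibniz (a : R) b)

/-- A finitely generated simple differential ring over `k(x)` whose generators span a differential
ring over the functions regular at all but finitely many points embeds into Laurent series. -/
theorem exists_embedding_of_simple {k : Type u} [Field k] [CharZero k] {R : Type v} [CommRing R]
    [Differential R] [Algebra (RatFunc k) R] [DifferentialAlgebra (RatFunc k) R]
    (hR : IsSimpleDifferentialRing R) {G : Set R} (hGfin : G.Finite)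
    (hG : Algebra.adjoin (RatFunc k) G = ⊤) (s : Finset (RatFunc k))
    (hs : ∀ α : k, (∀ f ∈ s, f ∈ regularAt α) →
      ∀ g ∈ G, g′ ∈ Algebra.adjoin (regularAt α) G) :
    ∃ (α : k) (k' : Type u) (_ : Field k') (_ : Algebra k k') (φ : R →+* LaurentSeries k'),
      FiniteDimensional k k' ∧ Function.Injective φ ∧
      (∀ f : RatFunc k, φ (algebraMap (RatFunc k) R f) = ratExpansion k' α f) ∧
      ∀ r : R, φ (r′) = (φ r)′ := by
  have := hR.1
  obtain ⟨α, hα, k', _, _, ψ, hfin, hψ⟩ := exists_point hGfin hG s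
  have : CharZero k' := charZero_of_injective_algebraMap (algebraMap k k').injective
  let S : Subalgebra (regularAt α) R := Algebra.adjoin (regularAt α) G
  have hA (a : regularAt α) : (algebraMap (regularAt α) R a)′ =
      algebraMap (regularAt α) R ⟨(a : RatFunc k)′, deriv_mem_regularAt a.2⟩ :=
    DifferentialAlgebra.deriv_algebraMap (a : RatFunc k)
  have hS : ∀ r ∈ S, r′ ∈ S := fun r hr ↦ deriv_mem_adjoin Differential.deriv
    (fun a ↦ hA a ▸ Subalgebra.algebraMap_mem S _) (hs α hα) hr
  let D : Derivation ℤ S S := restrictDerivation Differential.deriv S hS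
  have hDA (a : regularAt α) : D (algebraMap (regularAt α) S a) =
      algebraMap (regularAt α) S ⟨(a : RatFunc k)′, deriv_mem_regularAt a.2⟩ := Subtype.ext (hA a)
  let T : S →+* LaurentSeries k' := (HahnSeries.ofPowerSeries ℤ k').comp (taylorHom D ψ)
  have hTD (x : S) : T (D x) = (T x)′ := by
    change _ = Differential.deriv (HahnSeries.ofPowerSeries ℤ k' _)
    rw [deriv_ofPowerSeries]
    exact congrArg (HahnSeries.ofPowerSeries ℤ k') (derivative_taylorFun D ψ x).symm
  have hTpoly (p : Polynomial k) :
      T (algebraMap (regularAt α) S ⟨_, algebraMap_mem_regularAt α p⟩) =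
        polyExpansion k' α p := by
    let ι : Polynomial k →+* regularAt α :=
      (algebraMap (Polynomial k) (RatFunc k)).codRestrict _ (algebraMap_mem_regularAt α)
    suffices h : (T.comp (algebraMap (regularAt α) S)).comp ι = polyExpansion k' α from
      congrArg (fun f : Polynomial k →+* _ ↦ f p) h
    -- Derivatives `0` and `1`, together with the values of `ψ`, force the Taylor series of `c` and
    -- `x` to be `c` and `α + w`.
    refine Polynomial.ringHom_ext (fun c ↦ ?_) ?_
    · have h0 : D (algebraMap (regularAt α) S (ι (Polynomial.C c))) = 0 := by
        rw [hDA, ← map_zero (algebraMap (regularAt α) S)]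
        congr 1
        exact Subtype.ext ((congrArg (·′) (RatFunc.algebraMap_C c)).trans (deriv_ratFunc_C c))
      have h1 : evalAt α (ι (Polynomial.C c)) = c :=
        (congrArg (RatFunc.eval (RingHom.id k) α) (RatFunc.algebraMap_C c)).trans (by simp)
      change HahnSeries.ofPowerSeries ℤ k' (taylorFun D ψ _) = _
      rw [taylorFun_of_deriv_eq_zero D ψ h0, hψ, h1]
      simp [polyExpansion]
    · have h0 : D (algebraMap (regularAt α) S (ι Polynomial.X)) = 1 := by
        rw [hDA, ← map_one (algebraMap (regularAt α) S)]
        congr 1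
        exact Subtype.ext ((congrArg (·′) RatFunc.algebraMap_X).trans deriv_ratFunc_X)
      have h1 : evalAt α (ι Polynomial.X) = α :=
        (congrArg (RatFunc.eval (RingHom.id k) α) RatFunc.algebraMap_X).trans (by simp)
      change HahnSeries.ofPowerSeries ℤ k' (taylorFun D ψ _) = _
      rw [taylorFun_of_deriv_eq_one D ψ h0, hψ, h1]
      simp [polyExpansion]
  have hTA (a : regularAt α) : T (algebraMap (regularAt α) S a) = ratExpansion k' α a := by
    have hpoly (p : Polynomial k) :
        ratExpansion k' α (algebraMap _ _ p) = polyExpansion k' α p :=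
      RatFunc.liftRingHom_algebraMap _ _ p
    have hd : (a : RatFunc k).denom ≠ 0 := RatFunc.denom_ne_zero _
    have hd' : polyExpansion k' α (a : RatFunc k).denom ≠ 0 :=
      (map_ne_zero_iff _ (polyExpansion_injective k' α)).mpr hd
    have h : a * ⟨_, algebraMap_mem_regularAt α (a : RatFunc k).denom⟩ =
        ⟨_, algebraMap_mem_regularAt α (a : RatFunc k).num⟩ := by
      refine Subtype.ext ?_
      change (a : RatFunc k) * _ = _
      nth_rewrite 1 [← RatFunc.num_div_denom (a : RatFunc k)]
      exact div_mul_cancel₀ _ (RatFunc.algebraMap_ne_zero hd)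
    apply mul_right_cancel₀ hd'
    rw [← hTpoly, ← map_mul, ← map_mul, h, hTpoly, hTpoly, ← hpoly, ← hpoly, ← map_mul]
    exact congrArg _ (congrArg Subtype.val h).symm
  have hloc := isLocalization_adjoin_regularAt α hG
  -- By `hTA` these expansions agree with the field embedding `ratExpansion`, so nonzero elements go
  -- to units.
  have hunit (y : Algebra.algebraMapSubmonoid S (nonZeroDivisors (regularAt α))) :
      IsUnit (T y) := by
    obtain ⟨_, a, ha, rfl⟩ := y
    refine IsUnit.mk0 _ ?_
    change T (algebraMap (regularAt α) S a) ≠ 0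
    rw [hTA, Ne, map_eq_zero, ZeroMemClass.coe_eq_zero]
    exact nonZeroDivisors.ne_zero ha
  let φ : R →+* LaurentSeries k' := IsLocalization.lift hunit
  have hφ (x : S) : φ x = T x := IsLocalization.lift_eq hunit x
  have hφD : ∀ r : R, φ (r′) = (φ r)′ :=
    lift_deriv (Algebra.algebraMapSubmonoid S (nonZeroDivisors (regularAt α))) D
      (fun _ ↦ rfl) φ fun x ↦ by
        change φ ((D x : S) : R) = Differential.deriv (φ (x : R))
        rw [hφ, hφ, hTD]
  refine ⟨α, k', _, _, φ, hfin, injective_of_isSimple hR φ hφD, fun f ↦ ?_, hφD⟩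
  -- A general `f` may have a pole at `α`: it is a quotient of two regular functions, where the
  -- formula is known.
  obtain ⟨a, ha, ha0, haf⟩ := exists_mul_mem_regularAt α f
  have hreg (b : regularAt α) :
      φ (algebraMap (RatFunc k) R b) = ratExpansion k' α b := (hφ (algebraMap (regularAt α) S b)).trans (hTA b)
  have ha' : ratExpansion k' α a ≠ 0 := (map_ne_zero _).mpr ha0
  apply mul_left_cancel₀ ha'
  rw [← map_mul, ← hreg ⟨_, haf⟩, ← hreg ⟨a, ha⟩, map_mul, map_mul]

/-! ### Stability of the ring generated by a fundamental matrix -/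

/-- The derivative of the inverse of a unit. -/
lemma deriv_units_inv {R : Type*} [CommRing R] [Differential R] (d : Rˣ) :
    (d⁻¹).val′ = -(d⁻¹).val ^ 2 * d.val′ := by
  have h := congrArg (fun x : R ↦ x′) d.mul_inv
  simp only [Derivation.leibniz, smul_eq_mul, Derivation.map_one_eq_zero] at h
  have h1 := d.inv_mul
  linear_combination (d⁻¹).val * h - (d⁻¹).val′ * h1

lemma deriv_mem_adjoin_of_fundamental {A R : Type*} [CommRing A] [CommRing R] [Differential R]
    [Algebra A R] {n : ℕ} (B : Matrix (Fin n) (Fin n) A) (Y : GL (Fin n) R)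
    (hY : Y.val.map (fun r ↦ r′) = B.map (algebraMap A R) * Y.val)
    {g : R} (hg : g ∈ Set.range (fun ij : Fin n × Fin n ↦ Y.val ij.1 ij.2) ∪
        {((Matrix.GeneralLinearGroup.det Y)⁻¹ : Rˣ).val}) :
    g′ ∈ Algebra.adjoin A (Set.range (fun ij : Fin n × Fin n ↦ Y.val ij.1 ij.2) ∪
        {((Matrix.GeneralLinearGroup.det Y)⁻¹ : Rˣ).val}) := by
  set G := Set.range (fun ij : Fin n × Fin n ↦ Y.val ij.1 ij.2) ∪
        {((Matrix.GeneralLinearGroup.det Y)⁻¹ : Rˣ).val} with hGdef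
  have hYG (i j) : Y.val i j ∈ Algebra.adjoin A G :=
    Algebra.subset_adjoin (Or.inl ⟨(i, j), rfl⟩)
  have hYD (i j) : (Y.val i j)′ ∈ Algebra.adjoin A G := by
    have h := congrFun (congrFun hY i) j
    rw [Matrix.map_apply, Matrix.mul_apply] at h
    rw [h]
    exact sum_mem fun l _ ↦ mul_mem (Subalgebra.algebraMap_mem _ _) (hYG l j)
  -- Needed for the permutation expansion of `det Y`, whose derivative enters that of `det(Y)⁻¹`.
  have hprod {ι : Type} (t : Finset ι) (f : ι → R) (hf : ∀ i, f i ∈ Algebra.adjoin A G)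
      (hf' : ∀ i, (f i)′ ∈ Algebra.adjoin A G) : (∏ i ∈ t, f i)′ ∈ Algebra.adjoin A G := by
    classical
    induction t using Finset.induction_on with
    | empty => simp
    | insert i t hi ih =>
      rw [Finset.prod_insert hi, Derivation.leibniz]
      exact add_mem (mul_mem (hf i) ih) (mul_mem (prod_mem fun j _ ↦ hf j) (hf' i))
  rcases hg with ⟨⟨i, j⟩, rfl⟩ | rfl
  · exact hYD i j
  · rw [deriv_units_inv]
    have hd : (Matrix.GeneralLinearGroup.det Y)⁻¹.val ∈ Algebra.adjoin A G :=
      Algebra.subset_adjoin (Or.inr rfl)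
    refine mul_mem (neg_mem (pow_mem hd 2)) ?_
    change (Y.val.det)′ ∈ _
    rw [Matrix.det_apply', map_sum]
    refine sum_mem fun σ _ ↦ ?_
    rw [Derivation.leibniz, Derivation.map_intCast, smul_zero, add_zero]
    exact mul_mem (intCast_mem _ _) (hprod _ _ (fun i ↦ hYG _ _) fun i ↦ hYD _ _)

end PicardVessiot
end

theorem mainTheorem5 {k : Type u} [Field k] [CharZero k]
    (R : Type v) [CommRing R] [Differential R] [Algebra (RatFunc k) R]
    [DifferentialAlgebra (RatFunc k) R]
    (hR : PicardVessiot.IsPicardVessiotRing (RatFunc k) R) :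
    ∃ (α : k) (k' : Type u) (_ : Field k') (_ : Algebra k k') (φ : R →+* LaurentSeries k'),
      FiniteDimensional k k' ∧
      Function.Injective φ ∧
      (∀ f : RatFunc k, φ (algebraMap (RatFunc k) R f) = PicardVessiot.ratExpansion k' α f) ∧
      ∀ r : R, φ (Differential.deriv r) = Differential.deriv (φ r) := by
  classical
  obtain ⟨n, A, ⟨Y, hY, hG⟩, hsimple, -⟩ := hR
  refine PicardVessiot.exists_embedding_of_simple hsimple
    ((Set.finite_range _).union (Set.finite_singleton _)) hG
    -- Avoiding the poles of `A` lets the equation `Y′ = A Y` be read over `regularAt α`.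
    (Finset.univ.image fun ij : Fin n × Fin n ↦ A ij.1 ij.2) fun α hα g hg ↦ ?_
  have hA (i j) : A i j ∈ PicardVessiot.regularAt α :=
    hα _ (Finset.mem_image_of_mem (fun ij : Fin n × Fin n ↦ A ij.1 ij.2) (Finset.mem_univ (i, j)))
  exact PicardVessiot.deriv_mem_adjoin_of_fundamental
    (Matrix.of fun i j ↦ (⟨A i j, hA i j⟩ : PicardVessiot.regularAt α)) Y hY hg
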